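/- For $z,w$ in the open unit disk $\mathbb{D}$ let $\rho(z,w)=\left|\frac{z-w}{1-\overline{w}z}\right|$ be the pseudohyperbolic distance, and for a finite set $S=\{z_1,\dots,z_m\}\subset\mathbb{D}$ of $m\ge 1$ distinct points let $$\delta_S=\min_{1\le j\le m}\ \prod_{k\ne j}\rho(z_j,z_k)$$ (an empty product is $1$) be its separation constant. For $0<\delta\le 1$ let $$M(\delta)=\left(\frac1\delta+\sqrt{\frac1{\delta^2}-1}\right)^2 .$$ Theorem. Let $n\ge 1$ and let $A$ be a complex $n\times n$ matrix with $\|A\|\le 1$, where $\|\cdot\|$ is the operator norm induced by the Euclidean norm. Suppose that $A$ has $n$ distinct eigenvalues and that its spectrum $\sigma(A)$ is contained in $\mathbb{D}$. Put $\delta_A=\delta_{\sigma(A)}$. Then for every $f\in H^\infty$, that is, every bounded analytic function $f$ on $\mathbb{D}$, $$\|f(A)\|\le M(\delta_A)\,\max_{z\in\sigma(A)}|f(z)| ,$$ where $f(A)=X f(\Lambda)X^{-1}$ for any (equivalently, every) factorization $A=X\Lambda X^{-1}$ with $X$ invertible and $\Lambda=\operatorname{diag}(\lambda_1,\dots,\lambda_n)$,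 and $f(\Lambda)=\operatorname{diag}(f(\lambda_1),\dots,f(\lambda_n))$. (Such a factorization exists because the eigenvalues are distinct, and the value $f(A)$ is well defined.) -/

import Mathlib

open scoped Matrix.Norms.L2Operator

namespace CrouzeixBound

/-- The pseudohyperbolic distance of two points `z`, `w` of the open unit disk. -/
noncomputable def pseudoDist (z w : ℂ) : ℝ :=
  ‖(z - w) / (1 - (starRingEnd ℂ) w * z)‖

/-- The separation constant `inf_j ∏_{k ≠ j} ρ(z_j, z_k)` of a finite or infinite family of points
of the open unit disk. (For a finite index type the product is an ordinary finite product, equal to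
`1` if it is empty; for an infinite one it is the limit of the finite products, whose factors lie in
`[0, 1)`.) -/
noncomputable def separationConst {ι : Type*} (z : ι → ℂ) : ℝ :=
  ⨅ j : ι, ∏' k : {k : ι // k ≠ j}, pseudoDist (z j) (z k)

/-- `δ_A`: the separation constant of the set of eigenvalues of `A`. -/
noncomputable def matrixSeparationConst {n : ℕ} (A : Matrix (Fin n) (Fin n) ℂ) : ℝ :=
  separationConst (fun z : spectrum ℂ A => (z : ℂ))

/-- `M(δ) = (1/δ + √(1/δ² - 1))²`. -/
noncomputable def earlConst (δ : ℝ) : ℝ :=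
  (1 / δ + Real.sqrt (1 / δ ^ 2 - 1)) ^ 2

/-- `f` is (on the open unit disk) a bounded analytic function, that is, `f ∈ H^∞`. -/
def MemHInfty (f : ℂ → ℂ) : Prop :=
  DifferentiableOn ℂ f (Metric.ball 0 1) ∧ ∃ C : ℝ, ∀ z ∈ Metric.ball (0 : ℂ) 1, ‖f z‖ ≤ C

/-- `A = X Λ X⁻¹` with `X` invertible and `Λ = diag(d)`. -/
def IsDiagonalization {n : ℕ} (A : Matrix (Fin n) (Fin n) ℂ)
    (X : (Matrix (Fin n) (Fin n) ℂ)ˣ) (d : Fin n → ℂ) : Prop :=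
  A = (X : Matrix (Fin n) (Fin n) ℂ) * Matrix.diagonal d *
    ((X⁻¹ : (Matrix (Fin n) (Fin n) ℂ)ˣ) : Matrix (Fin n) (Fin n) ℂ)

open Classical in
/-- `f(A) = X f(Λ) X⁻¹` for a diagonalizable matrix `A = X Λ X⁻¹` (and `0` if `A` is not
diagonalizable). The value does not depend on the diagonalization, see `matrixFun_eq`. -/
noncomputable def matrixFun {n : ℕ} (f : ℂ → ℂ) (A : Matrix (Fin n) (Fin n) ℂ) :
    Matrix (Fin n) (Fin n) ℂ :=
  if h : ∃ p : (Matrix (Fin n) (Fin n) ℂ)ˣ × (Fin n → ℂ), IsDiagonalization A p.1 p.2 then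
    (h.choose.1 : Matrix (Fin n) (Fin n) ℂ) * Matrix.diagonal (fun i => f (h.choose.2 i)) *
      ((h.choose.1⁻¹ : (Matrix (Fin n) (Fin n) ℂ)ˣ) : Matrix (Fin n) (Fin n) ℂ)
  else 0

/-- `f(A) = X f(Λ) X⁻¹` for every diagonalization `A = X Λ X⁻¹`. -/
theorem matrixFun_eq {n : ℕ} (f : ℂ → ℂ) {A : Matrix (Fin n) (Fin n) ℂ}
    {X : (Matrix (Fin n) (Fin n) ℂ)ˣ} {d : Fin n → ℂ} (hX : IsDiagonalization A X d) :
    matrixFun f A = (X : Matrix (Fin n) (Fin n) ℂ) * Matrix.diagonal (fun i => f (d i)) *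
      ((X⁻¹ : (Matrix (Fin n) (Fin n) ℂ)ˣ) : Matrix (Fin n) (Fin n) ℂ) := by
  have h : ∃ p : (Matrix (Fin n) (Fin n) ℂ)ˣ × (Fin n → ℂ), IsDiagonalization A p.1 p.2 :=
    ⟨(X, d), hX⟩
  rw [matrixFun, dif_pos h]
  have hY := h.choose_spec
  generalize h.choose = p at hY ⊢
  obtain ⟨Y, e⟩ := p
  simp only [IsDiagonalization] at hX hY ⊢
  have hXY := hX.symm.trans hY
  have hP : ((Y⁻¹ * X : (Matrix (Fin n) (Fin n) ℂ)ˣ) : Matrix (Fin n) (Fin n) ℂ) *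
      Matrix.diagonal d = Matrix.diagonal e * ((Y⁻¹ * X : (Matrix (Fin n) (Fin n) ℂ)ˣ) :
        Matrix (Fin n) (Fin n) ℂ) := by
    have h1 := congrArg (fun B => (Y⁻¹ : (Matrix (Fin n) (Fin n) ℂ)ˣ) * B *
      (X : Matrix (Fin n) (Fin n) ℂ)) hXY
    simpa [mul_assoc] using h1
  have hPf : ((Y⁻¹ * X : (Matrix (Fin n) (Fin n) ℂ)ˣ) : Matrix (Fin n) (Fin n) ℂ) *
      Matrix.diagonal (fun i => f (d i)) = Matrix.diagonal (fun i => f (e i)) *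
        ((Y⁻¹ * X : (Matrix (Fin n) (Fin n) ℂ)ˣ) : Matrix (Fin n) (Fin n) ℂ) := by
    ext i j
    have hij := congrFun (congrFun hP i) j
    rw [Matrix.mul_diagonal, Matrix.diagonal_mul] at hij ⊢
    by_cases h0 : ((Y⁻¹ * X : (Matrix (Fin n) (Fin n) ℂ)ˣ) : Matrix (Fin n) (Fin n) ℂ) i j = 0
    · rw [h0]; simp
    · have hde : d j = e i := mul_left_cancel₀ h0 (by rw [hij, mul_comm])
      rw [hde, mul_comm]
  have h2 := congrArg (fun B => (Y : Matrix (Fin n) (Fin n) ℂ) * B *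
    ((X⁻¹ : (Matrix (Fin n) (Fin n) ℂ)ˣ) : Matrix (Fin n) (Fin n) ℂ)) hPf
  simpa [mul_assoc] using h2.symm

/-- A matrix of size `n` with `n` distinct eigenvalues is diagonalizable. -/
theorem exists_isDiagonalization {n : ℕ} {A : Matrix (Fin n) (Fin n) ℂ}
    (hA : (spectrum ℂ A).ncard = n) : ∃ X d, IsDiagonalization A X d := by
  classical
  have hfin : (spectrum ℂ A).Finite := by
    rcases Nat.eq_zero_or_pos n with rfl | hpos
    · exact Set.Finite.subset Set.finite_empty (by simp [spectrum.of_subsingleton])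
    · exact Set.finite_of_ncard_pos (by omega)
  have := hfin.fintype
  have hcard : Fintype.card (spectrum ℂ A) = n := by
    rw [← Nat.card_eq_fintype_card]; exact hA
  let σ : Fin n ≃ spectrum ℂ A := (Fintype.equivFinOfCardEq hcard).symm
  have hev : ∀ i, ∃ v, Module.End.HasEigenvector (Matrix.toLin' A) (σ i : ℂ) v := fun i => by
    have h1 : (σ i : ℂ) ∈ spectrum ℂ (Matrix.toLin' A) := by
      rw [Matrix.spectrum_toLin']; exact (σ i).2
    exact (Module.End.hasEigenvalue_iff_mem_spectrum.mpr h1).exists_hasEigenvector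
  choose v hv using hev
  have hli : LinearIndependent ℂ v := Module.End.eigenvectors_linearIndependent' (Matrix.toLin' A)
    (fun i => (σ i : ℂ)) (fun i j h => σ.injective (Subtype.ext h)) v hv
  let P : Matrix (Fin n) (Fin n) ℂ := (Matrix.of v).transpose
  have hP : IsUnit P := Matrix.linearIndependent_cols_iff_isUnit.mp hli
  obtain ⟨X, hX⟩ := hP
  refine ⟨X, fun i => (σ i : ℂ), ?_⟩
  rw [IsDiagonalization, Units.eq_mul_inv_iff_mul_eq, hX]
  ext i j
  have h2 := congrFun (hv j).apply_eq_smul i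
  rw [Matrix.toLin'_apply] at h2
  rw [Matrix.mul_diagonal]
  simpa [P, Matrix.mul_apply, Matrix.mulVec, dotProduct, mul_comm] using h2

end CrouzeixBound

namespace CrouzeixBound

open Complex Metric Set Polynomial ComplexConjugate

/-! ### Analytic functions with sign conditions on the unit circle -/

/-! The proof reduces to Earl's interpolation theorem. Let `ρ` be the smaller root of `δ (1 + ρ²) =
2 ρ`, so that `M(δ) = ρ⁻²`. For `0 < r < ρ`, any data of modulus at most `r²` on the spectrum are
the values of a Blaschke product `B` with `n` zeros (`exists_blaschkeValues_eq`). With `S` the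
maximum of `|f|` on the spectrum, interpolating `r² f / S` gives `r² f(A) = S B(A)`. Each Blaschke
factor of a contraction is a contraction, so `‖B(A)‖ ≤ 1`; then let `r → ρ`.

Earl's theorem is a continuity argument along the segment `t w`, `0 ≤ t ≤ 1`, with zeros `ζ k`
confined to pseudohyperbolic disks of radius `r` around `z k`. The attained `t` form a closed set by
compactness. For openness, separation forces `∏_{k ≠ j} ρ(z j, ζ k) > r` (`lt_prod_pseudoDist`).
Hence values of modulus at most `r²` keep every zero strictly inside its disk, and the zeros stay
distinct. At distinct zeros the map from zeros to values is open (`map_nhds_blaschkeValues`),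
because its real derivative is injective (`eq_zero_of_eval_derivNumerator`). -/

theorem circleAverage_re_of_diffContOnCl {h : ℂ → ℂ} (hd : DiffContOnCl ℂ h (ball 0 1)) :
    Real.circleAverage (fun x => (h x).re) 0 1 = (h 0).re := by
  have hint : CircleIntegrable h 0 1 := by
    refine ContinuousOn.circleIntegrable zero_le_one ?_
    exact hd.continuousOn_ball.mono sphere_subset_closedBall
  have h1 : Real.circleAverage h 0 1 = h 0 := by
    apply DiffContOnCl.circleAverage; simpa using hd
  have h2 := Complex.reCLM.circleAverage_comp_comm hint
  rw [h1] at h2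
  simpa [Function.comp_def] using h2

/-- The strong maximum principle for the real part, at the center of the unit disk. -/
theorem re_eq_zero_on_sphere {h : ℂ → ℂ} (hd : DiffContOnCl ℂ h (ball 0 1)) (h0 : (h 0).re = 0)
    (hle : ∀ x ∈ sphere (0 : ℂ) 1, (h x).re ≤ 0) : ∀ x ∈ sphere (0 : ℂ) 1, (h x).re = 0 := by
  intro x hx
  by_contra hne
  have hav := circleAverage_re_of_diffContOnCl hd
  rw [h0, Real.circleAverage_def, smul_eq_mul, mul_eq_zero, or_iff_right (by positivity)] at hav
  have hc : ContinuousOn (fun x => (h x).re) (sphere 0 1) :=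
    Complex.continuous_re.comp_continuousOn
      (hd.continuousOn_ball.mono sphere_subset_closedBall)
  have hmem : ∀ θ, circleMap 0 1 θ ∈ sphere (0 : ℂ) 1 := fun θ =>
    circleMap_mem_sphere 0 zero_le_one θ
  have hcc : Continuous fun θ => (h (circleMap 0 1 θ)).re :=
    hc.comp_continuous (continuous_circleMap 0 1) hmem
  obtain ⟨θ, hθ, rfl⟩ : x ∈ circleMap 0 1 '' Ioc 0 (2 * Real.pi) := by
    rw [image_circleMap_Ioc]; simpa using hx
  have hpos : 0 < ∫ θ in (0 : ℝ)..2 * Real.pi, -(h (circleMap 0 1 θ)).re := by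
    refine intervalIntegral.integral_pos Real.two_pi_pos hcc.neg.continuousOn
      (fun t _ => by have := hle _ (hmem t); linarith) ⟨θ, ⟨hθ.1.le, hθ.2⟩, ?_⟩
    have := lt_of_le_of_ne (hle _ hx) hne
    linarith
  rw [intervalIntegral.integral_neg, hav] at hpos
  simp at hpos

/-- If `φ` and `g` are analytic, `g 0 = 0`, and `φ` times a positive weight is `g - conj g` on the
unit circle, then `φ` vanishes there. -/
theorem eq_zero_on_sphere_of_mul_pos {φ g : ℂ → ℂ} {u : ℂ → ℝ}
    (hφ : DiffContOnCl ℂ φ (ball 0 1)) (hg : DiffContOnCl ℂ g (ball 0 1)) (hg0 : g 0 = 0)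
    (hu : ∀ x ∈ sphere (0 : ℂ) 1, 0 < u x)
    (h : ∀ x ∈ sphere (0 : ℂ) 1, φ x * u x = g x - conj (g x)) :
    ∀ x ∈ sphere (0 : ℂ) 1, φ x = 0 := by
  have hre : ∀ x ∈ sphere (0 : ℂ) 1, (φ x).re = 0 := fun x hx => by
    have h1 := congrArg Complex.re (h x hx)
    simpa [(hu x hx).ne'] using h1
  have him : ∀ x ∈ sphere (0 : ℂ) 1, (φ x).im * u x = 2 * (g x).im := fun x hx => by
    have h1 := congrArg Complex.im (h x hx)
    simp at h1
    linarith
  have hre0 : (φ 0).re = 0 := by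
    rw [← circleAverage_re_of_diffContOnCl hφ,
      Real.circleAverage_congr_sphere (f₂ := fun _ => (0 : ℝ))
        (fun x hx => hre x (by simpa using hx)),
      Real.circleAverage_const]
  -- On the circle the real part of `(φ - φ 0)²` is `-(Im φ - Im φ 0)² ≤ 0`, while at the center it
  -- is `0`. The maximum principle then makes `φ` constant on the circle.
  have hψ : DiffContOnCl ℂ (fun x => (φ x - φ 0) ^ 2) (ball 0 1) := by
    have h1 : DiffContOnCl ℂ (fun x => φ x - φ 0) (ball 0 1) := hφ.sub_const _
    simpa only [pow_two, smul_eq_mul] using h1.smul h1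
  have hconst : ∀ x ∈ sphere (0 : ℂ) 1, (φ x).im = (φ 0).im := fun x hx => by
    have h1 := re_eq_zero_on_sphere hψ (by simp) (fun x hx => by
      simp [pow_two, hre x hx, hre0]; nlinarith [sq_nonneg ((φ x).im - (φ 0).im)]) x hx
    simp [pow_two, hre x hx, hre0] at h1
    linarith
  have key : (φ 0).im = 0 := by
    have h1 : (1 : ℂ) ∈ sphere (0 : ℂ) 1 := by simp
    have hIg : DiffContOnCl ℂ (fun x => I * g x) (ball 0 1) := hg.const_smul I
    have hIg' : DiffContOnCl ℂ (fun x => -I * g x) (ball 0 1) := hg.const_smul (-I)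
    -- Since `2 Im g = (Im φ 0) u` has constant sign on the circle and `g 0 = 0`, the maximum
    -- principle applied to `± I g` gives `Im g = 0` there.
    have hz : (g 1).im = 0 := by
      rcases le_total 0 (φ 0).im with hy | hy
      · have := re_eq_zero_on_sphere hIg (by simp [hg0]) (fun x hx => by
          have h2 := him x hx
          rw [hconst x hx] at h2
          have := mul_nonneg hy (hu x hx).le
          simp; linarith) 1 h1
        simpa using this
      · have := re_eq_zero_on_sphere hIg' (by simp [hg0]) (fun x hx => by
          have h2 := him x hx
          rw [hconst x hx] at h2
          have := mul_nonpos_of_nonpos_of_nonneg hy (hu x hx).le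
          simp; linarith) 1 h1
        simpa using this
    have h2 := him 1 h1
    rw [hconst 1 h1, hz, mul_zero, mul_eq_zero] at h2
    exact h2.resolve_right (hu 1 h1).ne'
  intro x hx
  exact Complex.ext (hre x hx) (by rw [hconst x hx, key]; rfl)

/-! ### Blaschke products with prescribed zeros -/

/-- The Blaschke factor with zero `ζ`. -/
noncomputable def blaschkeFactor (ζ x : ℂ) : ℂ := (x - ζ) / (1 - conj ζ * x)

theorem one_sub_conj_mul_ne_zero {a b : ℂ} (ha : ‖a‖ < 1) (hb : ‖b‖ ≤ 1) : 1 - conj a * b ≠ 0 := by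
  intro h
  have h1 : ‖conj a * b‖ = 1 := by rw [← sub_eq_zero.mp h, norm_one]
  rw [norm_mul, RCLike.norm_conj] at h1
  nlinarith [norm_nonneg a, norm_nonneg b]

theorem one_sub_conj_mul_of_norm_eq_one (a : ℂ) {x : ℂ} (hx : ‖x‖ = 1) :
    1 - conj a * x = x * conj (x - a) := by
  have h : x * conj x = 1 := by rw [Complex.mul_conj']; simp [hx]
  rw [map_sub, mul_sub, h, mul_comm x]

section

variable {ι : Type*} [Fintype ι]

/-- The values at the points `z j` of the Blaschke product with zeros `ζ k`. -/
noncomputable def blaschkeValues (z ζ : ι → ℂ) (j : ι) : ℂ := ∏ k, blaschkeFactor (ζ k) (z j)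

/-- Differentiability is over `ℝ` because the zeros also enter through their conjugates. -/
theorem contDiffAt_blaschkeValues {z ζ : ι → ℂ} (h : ∀ j k, 1 - conj (ζ k) * z j ≠ 0) :
    ContDiffAt ℝ 1 (blaschkeValues z) ζ := by
  refine contDiffAt_pi.mpr fun j => ?_
  unfold blaschkeValues
  refine contDiffAt_prod fun k _ => ?_
  unfold blaschkeFactor
  have h1 : ContDiffAt ℝ 1 (fun η : ι → ℂ => η k) ζ := by fun_prop
  have h2 : ContDiffAt ℝ 1 (fun η : ι → ℂ => conj (η k)) ζ :=
    Complex.conjCLE.contDiff.contDiffAt.comp ζ h1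
  have h3 : ContDiffAt ℝ 1 (fun η : ι → ℂ => z j - η k) ζ := contDiffAt_const.sub h1
  have h4 : ContDiffAt ℝ 1 (fun η : ι → ℂ => 1 - conj (η k) * z j) ζ :=
    contDiffAt_const.sub (h2.mul contDiffAt_const)
  simp only [div_eq_mul_inv]
  exact h3.mul (h4.inv (h j k))

variable [DecidableEq ι]

/-- The numerator of the derivative in direction `v` of a Blaschke product as a function of its
zeros `ζ`. -/
noncomputable def derivNumerator (ζ v : ι → ℂ) : ℂ[X] :=
  ∑ k, (C (conj (v k)) * X * (X - C (ζ k)) - C (v k) * (1 - C (conj (ζ k)) * X)) *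
    ∏ l ∈ Finset.univ.erase k, ((X - C (ζ l)) * (1 - C (conj (ζ l)) * X))

theorem eval_derivNumerator (ζ v : ι → ℂ) (x : ℂ) : (derivNumerator ζ v).eval x =
    ∑ k, (conj (v k) * x * (x - ζ k) - v k * (1 - conj (ζ k) * x)) *
      ∏ l ∈ Finset.univ.erase k, ((x - ζ l) * (1 - conj (ζ l) * x)) := by
  simp [derivNumerator, eval_finsetSum, eval_prod]

/-- The logarithmic derivative of one Blaschke factor is `conj v x / (1 - conj ζ x) - v / (x - ζ)`,
and on the unit circle the two terms are conjugate to each other. -/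
theorem eval_derivNumerator_of_norm_eq_one {ζ : ι → ℂ} (v : ι → ℂ) (hζ : ∀ k, ‖ζ k‖ < 1) {x : ℂ}
    (hx : ‖x‖ = 1) : (derivNumerator ζ v).eval x =
    (∏ l, ((x - ζ l) * (1 - conj (ζ l) * x))) *
      ((∑ k, conj (v k) * x / (1 - conj (ζ k) * x)) -
        conj (∑ k, conj (v k) * x / (1 - conj (ζ k) * x))) := by
  rw [eval_derivNumerator, map_sum, ← Finset.sum_sub_distrib, Finset.mul_sum]
  refine Finset.sum_congr rfl fun k _ => ?_
  rw [← Finset.mul_prod_erase _ _ (Finset.mem_univ k), mul_right_comm ((x - ζ k) * _)]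
  congr 1
  have h1 := one_sub_conj_mul_ne_zero (hζ k) hx.le
  have hx0 : x ≠ 0 := fun h => by simp [h] at hx
  have h2 : x - ζ k ≠ 0 := fun h => by
    rw [sub_eq_zero] at h; have := hζ k; rw [← h, hx] at this; exact lt_irrefl _ this
  have h3 : conj (conj (v k) * x / (1 - conj (ζ k) * x)) = v k / (x - ζ k) := by
    rw [one_sub_conj_mul_of_norm_eq_one _ hx]
    have : conj x ≠ 0 := by simpa using hx0
    simp only [map_div₀, map_mul, Complex.conj_conj]
    field_simp
  rw [h3, div_sub_div _ _ h1 h2, mul_comm (x - ζ k) (1 - _), mul_div_cancel₀]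
  · ring
  · exact mul_ne_zero h1 h2

/-- This is the injectivity of the derivative of the values with respect to the zeros. Dividing the
numerator by `∏ (X - z j)` leaves `Q`, and on the circle `Q / ∏ (1 - conj (z j) x)` times a positive
weight has the form `g - conj g` with `g 0 = 0`. So `Q` vanishes on the circle and the numerator is
zero; evaluating it at each of the distinct `ζ m` isolates `v m`. -/
theorem eq_zero_of_eval_derivNumerator {z ζ v : ι → ℂ} (hz : ∀ j, ‖z j‖ < 1)
    (hζ : ∀ k, ‖ζ k‖ < 1) (hzi : Function.Injective z) (hζi : Function.Injective ζ)
    (h : ∀ j, (derivNumerator ζ v).eval (z j) = 0) : v = 0 := by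
  obtain ⟨Q, hQ⟩ : (∏ j, (X - C (z j))) ∣ derivNumerator ζ v :=
    Finset.prod_dvd_of_coprime
      (fun i _ j _ hij => pairwise_coprime_X_sub_C hzi hij)
      (fun j _ => dvd_iff_isRoot.mpr (h j))
  have hden : ∀ x, ‖x‖ ≤ 1 → ∏ j, (1 - conj (z j) * x) ≠ 0 := fun x hx =>
    Finset.prod_ne_zero_iff.mpr fun j _ => one_sub_conj_mul_ne_zero (hz j) hx
  have hmem : ∀ x ∈ closure (ball (0 : ℂ) 1), ‖x‖ ≤ 1 := fun x hx => by
    rw [closure_ball _ one_ne_zero] at hx; simpa using hx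
  have hφ : DiffContOnCl ℂ (fun x => Q.eval x / ∏ j, (1 - conj (z j) * x)) (ball 0 1) := by
    refine DifferentiableOn.diffContOnCl fun x hx => DifferentiableAt.differentiableWithinAt ?_
    refine DifferentiableAt.fun_div Q.differentiable.differentiableAt ?_ (hden x (hmem x hx))
    fun_prop
  have hg : DiffContOnCl ℂ (fun x => ∑ k, conj (v k) * x / (1 - conj (ζ k) * x)) (ball 0 1) := by
    refine DifferentiableOn.diffContOnCl fun x hx => DifferentiableAt.differentiableWithinAt ?_
    refine DifferentiableAt.fun_sum fun k _ => DifferentiableAt.fun_div (by fun_prop) (by fun_prop)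
      (one_sub_conj_mul_ne_zero (hζ k) (hmem x hx))
  have hne : ∀ (w : ι → ℂ), (∀ j, ‖w j‖ < 1) → ∀ x, ‖x‖ = 1 → ∀ j, x - w j ≠ 0 :=
    fun w hw x hx j h0 => by
      rw [sub_eq_zero] at h0; have := hw j; rw [← h0, hx] at this; exact lt_irrefl _ this
  have hzero := eq_zero_on_sphere_of_mul_pos
    -- On the circle `(x - a)(1 - conj a x) = x |x - a|²`, so the powers of `x` cancel in the
    -- quotient of the products for `z` and `ζ`, leaving this weight.
    (u := fun x => ∏ j, (‖x - z j‖ ^ 2 / ‖x - ζ j‖ ^ 2)) hφ hg (by simp)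
    (fun x hx => Finset.prod_pos fun j _ => by
      have hx' : ‖x‖ = 1 := by simpa using hx
      have h1 := norm_pos_iff.mpr (hne z hz x hx' j)
      have h2 := norm_pos_iff.mpr (hne ζ hζ x hx' j)
      positivity)
    (fun x hx => by
      have hx' : ‖x‖ = 1 := by simpa using hx
      have hN := eval_derivNumerator_of_norm_eq_one v hζ hx'
      rw [hQ, eval_mul, eval_prod] at hN
      simp only [eval_sub, eval_X, eval_C] at hN
      have hW : ∏ l, ((x - ζ l) * (1 - conj (ζ l) * x)) ≠ 0 := Finset.prod_ne_zero_iff.mpr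
        fun l _ => mul_ne_zero (hne ζ hζ x hx' l) (one_sub_conj_mul_ne_zero (hζ l) hx'.le)
      rw [← mul_right_inj' hW, ← hN]
      have hu : ((∏ j, (‖x - z j‖ ^ 2 / ‖x - ζ j‖ ^ 2) : ℝ) : ℂ) *
          ∏ l, ((x - ζ l) * (1 - conj (ζ l) * x)) =
          (∏ j, (x - z j)) * ∏ j, (1 - conj (z j) * x) := by
        rw [Complex.ofReal_prod, ← Finset.prod_mul_distrib, ← Finset.prod_mul_distrib]
        refine Finset.prod_congr rfl fun j _ => ?_
        have h2 := hne ζ hζ x hx' j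
        have h3 : conj (x - ζ j) ≠ 0 := by simpa [-map_sub] using h2
        rw [one_sub_conj_mul_of_norm_eq_one _ hx', one_sub_conj_mul_of_norm_eq_one _ hx']
        push_cast
        rw [← Complex.mul_conj', ← Complex.mul_conj']
        field_simp
      have := hden x hx'.le
      rw [mul_comm, mul_assoc, hu, div_mul_eq_mul_div, mul_comm (∏ j, (x - z j)), mul_left_comm,
        mul_div_cancel_left₀ _ this, mul_comm])
  have hN0 : derivNumerator ζ v = 0 := by
    refine Polynomial.eq_zero_of_infinite_isRoot _ (Set.Infinite.mono (s := sphere 0 1) ?_ ?_)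
    · intro x hx
      have h1 := (div_eq_zero_iff.mp (hzero x hx)).resolve_right (hden x (by simp_all))
      simp [hQ, IsRoot, h1]
    · refine (isPreconnected_sphere (by simp) (0 : ℂ) 1).infinite_of_nontrivial
        ⟨1, by simp, -1, by simp, ?_⟩
      norm_num [Complex.ext_iff]
  funext m
  have hm := eval_derivNumerator ζ v (ζ m)
  rw [hN0, eval_zero, Finset.sum_eq_single m] at hm
  · have h1 := one_sub_conj_mul_ne_zero (hζ m) (hζ m).le
    have h2 : ∏ l ∈ Finset.univ.erase m, ((ζ m - ζ l) * (1 - conj (ζ l) * ζ m)) ≠ 0 :=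
      Finset.prod_ne_zero_iff.mpr fun l hl => mul_ne_zero
        (sub_ne_zero.mpr fun h => (Finset.mem_erase.mp hl).1 (hζi h).symm)
        (one_sub_conj_mul_ne_zero (hζ l) (hζ m).le)
    have h3 := (mul_eq_zero.mp hm.symm).resolve_right h2
    simpa [h1] using h3
  · intro k _ hk
    rw [Finset.prod_eq_zero (Finset.mem_erase.mpr ⟨hk.symm, Finset.mem_univ m⟩) (by simp), mul_zero]
  · simp

theorem hasDerivAt_blaschkeFactor_line {ζ x : ℂ} (v : ℂ) (h : 1 - conj ζ * x ≠ 0) :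
    HasDerivAt (fun t : ℝ => blaschkeFactor (ζ + t * v) x)
      ((conj v * x * (x - ζ) - v * (1 - conj ζ * x)) / (1 - conj ζ * x) ^ 2) 0 := by
  have h0 : HasDerivAt (fun t : ℝ => (t : ℂ)) 1 0 := Complex.ofRealCLM.hasDerivAt
  have h1 : HasDerivAt (fun t : ℝ => x - (ζ + t * v)) (-v) 0 := by
    simpa using ((h0.mul_const v).const_add ζ).const_sub x
  have h2 : HasDerivAt (fun t : ℝ => 1 - conj (ζ + t * v) * x) (-(conj v * x)) 0 := by
    simpa using (((h0.mul_const (conj v)).const_add (conj ζ)).mul_const x).const_sub 1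
  refine (h1.div h2 (by simpa using h)).congr_deriv ?_
  simp only [ofReal_zero, zero_mul, add_zero]
  ring

theorem hasDerivAt_blaschkeValues_line {z ζ : ι → ℂ} (v : ι → ℂ) {j : ι}
    (h : ∀ k, 1 - conj (ζ k) * z j ≠ 0) :
    HasDerivAt (fun t : ℝ => blaschkeValues z (ζ + t • v) j)
      ((derivNumerator ζ v).eval (z j) / ∏ k, (1 - conj (ζ k) * z j) ^ 2) 0 := by
  have h1 := HasDerivAt.fun_finsetProd (u := Finset.univ)
    fun k _ => hasDerivAt_blaschkeFactor_line (v k) (h k)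
  have h2 : (fun t : ℝ => blaschkeValues z (ζ + t • v) j) =
      fun t : ℝ => ∏ k, blaschkeFactor (ζ k + t * v k) (z j) := by
    funext t; simp [blaschkeValues]
  rw [h2]
  refine h1.congr_deriv ?_
  rw [eval_derivNumerator, Finset.sum_div]
  refine Finset.sum_congr rfl fun k _ => ?_
  rw [← Finset.mul_prod_erase _ (fun k => (1 - conj (ζ k) * z j) ^ 2) (Finset.mem_univ k),
    mul_div_mul_comm, smul_eq_mul, mul_comm, ← Finset.prod_div_distrib]
  congr 1
  refine Finset.prod_congr rfl fun l _ => ?_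
  have := h l
  simp only [blaschkeFactor, ofReal_zero, zero_mul, add_zero]
  field_simp

/-- Source and target have the same finite real dimension, so injectivity of the derivative gives
surjectivity, hence openness at `ζ`. -/
theorem map_nhds_blaschkeValues {z ζ : ι → ℂ} (hz : ∀ j, ‖z j‖ < 1) (hζ : ∀ k, ‖ζ k‖ < 1)
    (hzi : Function.Injective z) (hζi : Function.Injective ζ) :
    Filter.map (blaschkeValues z) (nhds ζ) = nhds (blaschkeValues z ζ) := by
  have hne : ∀ j k, 1 - conj (ζ k) * z j ≠ 0 := fun j k =>
    one_sub_conj_mul_ne_zero (hζ k) (hz j).le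
  have hd := (contDiffAt_blaschkeValues hne).hasStrictFDerivAt one_ne_zero
  refine hd.map_nhds_eq_of_surj ?_
  rw [LinearMap.range_eq_top]
  refine (LinearMap.injective_iff_surjective (f := (fderiv ℝ (blaschkeValues z) ζ).toLinearMap)).mp
    ((injective_iff_map_eq_zero _).mpr fun v hv => ?_)
  refine eq_zero_of_eval_derivNumerator hz hζ hzi hζi fun j => ?_
  have hline : HasDerivAt (fun t : ℝ => ζ + t • v) v 0 := by
    simpa using ((hasDerivAt_id (0 : ℝ)).smul_const v).const_add ζ
  have h1 : HasFDerivAt (blaschkeValues z) (fderiv ℝ (blaschkeValues z) ζ) (ζ + (0 : ℝ) • v) := by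
    simpa using hd.hasFDerivAt
  have h2 := hasDerivAt_pi.mp (h1.comp_hasDerivAt 0 hline) j
  have h3 := h2.unique (hasDerivAt_blaschkeValues_line v (hne j))
  have hv' : fderiv ℝ (blaschkeValues z) ζ v = 0 := hv
  rw [hv', Pi.zero_apply, eq_comm, div_eq_zero_iff] at h3
  exact h3.resolve_right (Finset.prod_ne_zero_iff.mpr fun k _ => pow_ne_zero 2 (hne j k))

end

/-! ### The pseudohyperbolic distance -/

theorem pseudoDist_eq_div (z w : ℂ) : pseudoDist z w = ‖z - w‖ / ‖1 - conj w * z‖ := norm_div _ _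

theorem pseudoDist_nonneg (z w : ℂ) : 0 ≤ pseudoDist z w := norm_nonneg _

theorem pseudoDist_comm (z w : ℂ) : pseudoDist z w = pseudoDist w z := by
  rw [pseudoDist_eq_div, pseudoDist_eq_div, norm_sub_rev, ← RCLike.norm_conj (1 - conj w * z)]
  simp [mul_comm]

theorem one_sub_pseudoDist_sq {z w : ℂ} (h : 1 - conj w * z ≠ 0) :
    1 - pseudoDist z w ^ 2 = (1 - ‖z‖ ^ 2) * (1 - ‖w‖ ^ 2) / ‖1 - conj w * z‖ ^ 2 := by
  have h0 : ‖1 - conj w * z‖ ^ 2 ≠ 0 := by simpa using h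
  rw [pseudoDist_eq_div, div_pow, eq_div_iff h0, sub_mul, div_mul_cancel₀ _ h0, one_mul]
  simp only [← Complex.normSq_eq_norm_sq, Complex.normSq_apply]
  simp
  ring

theorem pseudoDist_lt_one {z w : ℂ} (hz : ‖z‖ < 1) (hw : ‖w‖ < 1) : pseudoDist z w < 1 := by
  have h := one_sub_conj_mul_ne_zero hw hz.le
  have h1 := one_sub_pseudoDist_sq h
  have h2 : 0 < (1 - ‖z‖ ^ 2) * (1 - ‖w‖ ^ 2) / ‖1 - conj w * z‖ ^ 2 := by
    have := norm_pos_iff.mpr h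
    have h3 : 0 < 1 - ‖z‖ ^ 2 := by nlinarith [norm_nonneg z]
    have h4 : 0 < 1 - ‖w‖ ^ 2 := by nlinarith [norm_nonneg w]
    positivity
  nlinarith [pseudoDist_nonneg z w]

theorem pseudoDist_blaschkeFactor {y z w : ℂ} (hy : ‖y‖ < 1) (hz : ‖z‖ < 1) (hw : ‖w‖ < 1) :
    pseudoDist (blaschkeFactor y z) (blaschkeFactor y w) = pseudoDist z w := by
  have h1 := one_sub_conj_mul_ne_zero hy hz.le
  have h2 := one_sub_conj_mul_ne_zero hy hw.le
  have h3 := one_sub_conj_mul_ne_zero hw hy.le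
  have h4 : 1 - conj y * y ≠ 0 := one_sub_conj_mul_ne_zero hy hy.le
  have h1' : 1 - z * conj y ≠ 0 := by rwa [mul_comm]
  have h2' : 1 - w * conj y ≠ 0 := by rwa [mul_comm]
  have h3' : 1 - y * conj w ≠ 0 := by rwa [mul_comm]
  have e1 : blaschkeFactor y z - blaschkeFactor y w =
      (z - w) * (1 - conj y * y) / ((1 - conj y * z) * (1 - conj y * w)) := by
    unfold blaschkeFactor
    field_simp
    ring
  have e2 : 1 - conj (blaschkeFactor y w) * blaschkeFactor y z =
      (1 - conj w * z) * (1 - conj y * y) / ((1 - conj y * z) * conj (1 - conj y * w)) := by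
    simp only [blaschkeFactor, map_div₀, map_sub, map_one, map_mul, Complex.conj_conj]
    field_simp
    ring
  rw [pseudoDist_eq_div, pseudoDist_eq_div, e1, e2]
  simp only [norm_div, norm_mul, RCLike.norm_conj]
  have n1 := norm_ne_zero_iff.mpr h1
  have n2 := norm_ne_zero_iff.mpr h2
  have n4 := norm_ne_zero_iff.mpr h4
  rw [div_div_div_cancel_right₀ (mul_ne_zero n1 n2), mul_div_mul_right _ _ n4]

/-- The strong triangle inequality relative to the origin. -/
theorem le_pseudoDist_of_norm_le {a b : ℂ} {r : ℝ} (hr : r < 1) (ha : ‖a‖ ≤ r) (hab : r ≤ ‖b‖)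
    (hb : ‖b‖ < 1) : (‖b‖ - r) / (1 - r * ‖b‖) ≤ pseudoDist b a := by
  have ha0 := norm_nonneg a
  have hb0 := norm_nonneg b
  have hne := one_sub_conj_mul_ne_zero (ha.trans_lt hr) hb.le
  have h1 := one_sub_pseudoDist_sq hne
  have hpos : 0 < 1 - ‖a‖ * ‖b‖ := by nlinarith
  have hpos' : 0 < 1 - r * ‖b‖ := by nlinarith
  have hle : 1 - ‖a‖ * ‖b‖ ≤ ‖1 - conj a * b‖ := by
    have := norm_sub_norm_le (1 : ℂ) (conj a * b)
    simpa using this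
  have h2 : (1 - ‖b‖ ^ 2) * (1 - ‖a‖ ^ 2) / ‖1 - conj a * b‖ ^ 2 ≤
      (1 - ‖b‖ ^ 2) * (1 - ‖a‖ ^ 2) / (1 - ‖a‖ * ‖b‖) ^ 2 := by
    have h3 : 0 ≤ 1 - ‖b‖ ^ 2 := by nlinarith
    have h4 : 0 ≤ 1 - ‖a‖ ^ 2 := by nlinarith
    gcongr
  have h3 : (1 - ‖b‖ ^ 2) * (1 - ‖a‖ ^ 2) / (1 - ‖a‖ * ‖b‖) ^ 2 =
      1 - ((‖b‖ - ‖a‖) / (1 - ‖a‖ * ‖b‖)) ^ 2 := by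
    rw [div_pow, eq_sub_iff_add_eq, ← add_div, div_eq_one_iff_eq (pow_ne_zero 2 hpos.ne')]
    ring
  -- The function `t ↦ (‖b‖ - t) / (1 - t ‖b‖)` is decreasing because `‖b‖ < 1`.
  calc (‖b‖ - r) / (1 - r * ‖b‖) ≤ (‖b‖ - ‖a‖) / (1 - ‖a‖ * ‖b‖) := by
        rw [div_le_div_iff₀ hpos' hpos]
        nlinarith [mul_nonneg (sub_nonneg.mpr ha) (show 0 ≤ 1 - ‖b‖ ^ 2 by nlinarith)]
    _ ≤ pseudoDist b a := by
        refine le_of_sq_le_sq ?_ (pseudoDist_nonneg _ _)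
        linarith

/-- A disk automorphism moves `y` to the origin, where the previous estimate applies. -/
theorem le_pseudoDist_of_pseudoDist_le {z y w : ℂ} {r : ℝ} (hz : ‖z‖ < 1) (hy : ‖y‖ < 1)
    (hw : ‖w‖ < 1) (hr : r < 1) (hyw : pseudoDist w y ≤ r) (hzy : r ≤ pseudoDist z y) :
    (pseudoDist z y - r) / (1 - r * pseudoDist z y) ≤ pseudoDist z w := by
  rw [← pseudoDist_blaschkeFactor hy hz hw]
  exact le_pseudoDist_of_norm_le hr hyw hzy (pseudoDist_lt_one hz hy)

/-! ### Earl's interpolation theorem -/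

/-- After clearing denominators the difference of the two sides is `r (1 + r) (1 - x) (1 - y) (1 - x
y)`. -/
theorem shrink_mul_le {r x y : ℝ} (hr0 : 0 ≤ r) (hr : r < 1) (hx : x ≤ 1) (hy : y ≤ 1)
    (hy0 : 0 ≤ y) :
    (x * y - r) / (1 - r * (x * y)) ≤ (x - r) / (1 - r * x) * ((y - r) / (1 - r * y)) := by
  have h1 : 0 < 1 - r * x := by nlinarith
  have h2 : 0 < 1 - r * y := by nlinarith
  have hxy : x * y ≤ 1 := by nlinarith
  have h3 : 0 < 1 - r * (x * y) := by nlinarith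
  rw [div_mul_div_comm, div_le_div_iff₀ h3 (mul_pos h1 h2)]
  have : (x - r) * (y - r) * (1 - r * (x * y)) - (x * y - r) * ((1 - r * x) * (1 - r * y)) =
      r * (1 + r) * ((1 - x) * (1 - y) * (1 - x * y)) := by
    ring
  have h4 : 0 ≤ r * (1 + r) * ((1 - x) * (1 - y) * (1 - x * y)) := mul_nonneg (by positivity)
    (mul_nonneg (mul_nonneg (sub_nonneg.mpr hx) (sub_nonneg.mpr hy)) (sub_nonneg.mpr hxy))
  linarith

/-- Moving each point by at most `r` shrinks each distance `x` at worst to `(x - r) / (1 - r x)`;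
submultiplicativity of this map bounds the loss in the whole product. As all factors are at most
`1`, `r ≤ ∏ x k` puts each factor above `r` and keeps the bounds nonnegative. -/
theorem shrink_prod_le {κ : Type*} {s : Finset κ} {r : ℝ} (hr0 : 0 ≤ r) (hr : r < 1) {x y : κ → ℝ}
    (hx0 : ∀ k ∈ s, 0 ≤ x k) (hx1 : ∀ k ∈ s, x k ≤ 1) (hprod : r ≤ ∏ k ∈ s, x k)
    (hxy : ∀ k ∈ s, r ≤ x k → (x k - r) / (1 - r * x k) ≤ y k) :
    (∏ k ∈ s, x k - r) / (1 - r * ∏ k ∈ s, x k) ≤ ∏ k ∈ s, y k := by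
  classical
  induction s using Finset.induction_on with
  | empty => simp [div_self (sub_ne_zero.mpr hr.ne')]
  | insert a s ha ih =>
    rw [Finset.prod_insert ha] at hprod ⊢
    rw [Finset.prod_insert ha]
    have ha0 := hx0 a (Finset.mem_insert_self a s)
    have ha1 := hx1 a (Finset.mem_insert_self a s)
    have hs0 : ∀ k ∈ s, 0 ≤ x k := fun k hk => hx0 k (Finset.mem_insert_of_mem hk)
    have hs1 : ∀ k ∈ s, x k ≤ 1 := fun k hk => hx1 k (Finset.mem_insert_of_mem hk)
    have hp0 : 0 ≤ ∏ k ∈ s, x k := Finset.prod_nonneg hs0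
    have hp1 : ∏ k ∈ s, x k ≤ 1 := Finset.prod_le_one hs0 hs1
    have hra : r ≤ x a := hprod.trans (mul_le_of_le_one_right ha0 hp1)
    have hrs : r ≤ ∏ k ∈ s, x k := hprod.trans (mul_le_of_le_one_left hp0 ha1)
    have h1 := hxy a (Finset.mem_insert_self a s) hra
    have h2 := ih hs0 hs1 hrs fun k hk => hxy k (Finset.mem_insert_of_mem hk)
    refine (shrink_mul_le hr0 hr ha1 hp1 hp0).trans (mul_le_mul h1 h2 ?_ ?_)
    · exact div_nonneg (sub_nonneg.mpr hrs) (by nlinarith)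
    · exact le_trans (div_nonneg (sub_nonneg.mpr hra) (by nlinarith)) h1

section

variable {ι : Type*}

/-- The product of the closed pseudohyperbolic disks of radius `r` around the points `z k`. -/
def closedPseudoPolydisk (z : ι → ℂ) (r : ℝ) : Set (ι → ℂ) :=
  {ζ | ∀ k, ‖ζ k‖ ≤ 1 ∧ ‖ζ k - z k‖ ≤ r * ‖1 - conj (z k) * ζ k‖}

/-- The polydisk is defined with denominators cleared, which makes it closed but seems to allow
boundary points. On the unit circle, however, the condition becomes `‖ζ k - z k‖ ≤ r ‖ζ k - z k‖`,
impossible for `r < 1`. -/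
theorem norm_lt_one_of_mem_closedPseudoPolydisk {z ζ : ι → ℂ} {r : ℝ} (hr : r < 1)
    (hz : ∀ j, ‖z j‖ < 1) (h : ζ ∈ closedPseudoPolydisk z r) (k : ι) : ‖ζ k‖ < 1 := by
  obtain ⟨h1, h2⟩ := h k
  refine lt_of_le_of_ne h1 fun h3 => ?_
  rw [one_sub_conj_mul_of_norm_eq_one _ h3, norm_mul, RCLike.norm_conj, h3, one_mul] at h2
  have h4 : 0 < ‖ζ k - z k‖ := norm_pos_iff.mpr fun h5 => by
    have := hz k
    rw [← sub_eq_zero.mp h5, h3] at this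
    exact lt_irrefl _ this
  nlinarith

theorem pseudoDist_le_of_mem_closedPseudoPolydisk {z ζ : ι → ℂ} {r : ℝ}
    (hz : ∀ j, ‖z j‖ < 1) (h : ζ ∈ closedPseudoPolydisk z r) (k : ι) :
    pseudoDist (ζ k) (z k) ≤ r := by
  obtain ⟨h1, h2⟩ := h k
  rwa [pseudoDist_eq_div, div_le_iff₀ (norm_pos_iff.mpr (one_sub_conj_mul_ne_zero (hz k) h1))]

variable [Fintype ι]

theorem isCompact_closedPseudoPolydisk (z : ι → ℂ) (r : ℝ) :
    IsCompact (closedPseudoPolydisk z r) := by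
  refine Metric.isCompact_of_isClosed_isBounded ?_ ?_
  · simp only [closedPseudoPolydisk, Set.ofPred_forall, Set.ofPred_and]
    refine isClosed_iInter fun k => (isClosed_le (by fun_prop) (by fun_prop)).inter
      (isClosed_le (by fun_prop) ?_)
    have : Continuous fun ζ : ι → ℂ => ζ k := continuous_apply k
    fun_prop
  · refine (Metric.isBounded_closedBall (x := (0 : ι → ℂ)) (r := 1)).subset fun ζ hζ => ?_
    rw [mem_closedBall_zero_iff, pi_norm_le_iff_of_nonneg zero_le_one]
    exact fun k => (hζ k).1

variable [DecidableEq ι]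

theorem norm_blaschkeValues (z ζ : ι → ℂ) (j : ι) : ‖blaschkeValues z ζ j‖ =
    pseudoDist (z j) (ζ j) * ∏ k ∈ Finset.univ.erase j, pseudoDist (z j) (ζ k) := by
  rw [blaschkeValues, norm_prod, ← Finset.mul_prod_erase _ _ (Finset.mem_univ j)]
  rfl

/-- The condition `2 r < δ (1 + r²)` says exactly that the shrunken separation `(δ - r) / (1 - r δ)`
still exceeds `r`. -/
theorem lt_prod_pseudoDist {z ζ : ι → ℂ} {r δ : ℝ} (hz : ∀ j, ‖z j‖ < 1) (hr0 : 0 < r) (hr : r < 1)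
    (hrδ : 2 * r < δ * (1 + r ^ 2)) {j : ι}
    (hδ : δ ≤ ∏ k ∈ Finset.univ.erase j, pseudoDist (z j) (z k))
    (hζ : ζ ∈ closedPseudoPolydisk z r) :
    r < ∏ k ∈ Finset.univ.erase j, pseudoDist (z j) (ζ k) := by
  have hle1 : ∏ k ∈ Finset.univ.erase j, pseudoDist (z j) (z k) ≤ 1 :=
    Finset.prod_le_one (fun k _ => pseudoDist_nonneg _ _)
      fun k _ => (pseudoDist_lt_one (hz j) (hz k)).le
  have hrδ' : r < δ := by nlinarith
  refine lt_of_lt_of_le ?_ (shrink_prod_le hr0.le hr (fun k _ => pseudoDist_nonneg _ _)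
    (fun k _ => (pseudoDist_lt_one (hz j) (hz k)).le) (hrδ'.le.trans hδ)
    (fun k _ hk => le_pseudoDist_of_pseudoDist_le (hz j) (hz k)
      (norm_lt_one_of_mem_closedPseudoPolydisk hr hz hζ k) hr
      (pseudoDist_le_of_mem_closedPseudoPolydisk hz hζ k) hk))
  rw [lt_div_iff₀ (by nlinarith)]
  nlinarith

/-- If `ζ j = ζ k`, then `ρ(z j, ζ k) ≤ r` is a factor of the product that was shown to exceed `r`.
-/
theorem injective_of_mem_closedPseudoPolydisk {z ζ : ι → ℂ} {r δ : ℝ} (hz : ∀ j, ‖z j‖ < 1)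
    (hr0 : 0 < r) (hr : r < 1) (hrδ : 2 * r < δ * (1 + r ^ 2))
    (hδ : ∀ j, δ ≤ ∏ k ∈ Finset.univ.erase j, pseudoDist (z j) (z k))
    (hζ : ζ ∈ closedPseudoPolydisk z r) : Function.Injective ζ := by
  intro j k hjk
  by_contra hne
  have hζ1 := norm_lt_one_of_mem_closedPseudoPolydisk hr hz hζ
  have h1 := lt_prod_pseudoDist hz hr0 hr hrδ (hδ j) hζ
  have h2 : ∏ k ∈ Finset.univ.erase j, pseudoDist (z j) (ζ k) ≤ pseudoDist (z j) (ζ k) := by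
    rw [← Finset.mul_prod_erase _ _ (Finset.mem_erase.mpr ⟨Ne.symm hne, Finset.mem_univ k⟩)]
    exact mul_le_of_le_one_right (pseudoDist_nonneg _ _) (Finset.prod_le_one
      (fun l _ => pseudoDist_nonneg _ _) fun l _ => (pseudoDist_lt_one (hz j) (hζ1 l)).le)
  have h3 := pseudoDist_le_of_mem_closedPseudoPolydisk hz hζ j
  rw [pseudoDist_comm, hjk] at h3
  linarith

/-- **Earl's theorem**: small values at separated points are interpolated by a Blaschke product
whose zeros are close to these points. -/
theorem exists_blaschkeValues_eq {z : ι → ℂ} {r δ : ℝ} (hz : ∀ j, ‖z j‖ < 1)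
    (hzi : Function.Injective z) (hr0 : 0 < r) (hr : r < 1) (hrδ : 2 * r < δ * (1 + r ^ 2))
    (hδ : ∀ j, δ ≤ ∏ k ∈ Finset.univ.erase j, pseudoDist (z j) (z k))
    {w : ι → ℂ} (hw : ∀ j, ‖w j‖ ≤ r ^ 2) :
    ∃ ζ : ι → ℂ, (∀ k, ‖ζ k‖ < 1) ∧ blaschkeValues z ζ = w := by
  set K := closedPseudoPolydisk z r
  have hK1 : ∀ ζ ∈ K, ∀ k, ‖ζ k‖ < 1 := fun ζ hζ =>
    norm_lt_one_of_mem_closedPseudoPolydisk hr hz hζ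
  have hcont : ContinuousOn (blaschkeValues z) K := fun ζ hζ =>
    (contDiffAt_blaschkeValues fun j k =>
      one_sub_conj_mul_ne_zero (hK1 ζ hζ k) (hz j).le).continuousAt.continuousWithinAt
  have hpath : Continuous fun t : ℝ => t • w := by fun_prop
  have hclosed : IsClosed ((fun t : ℝ => t • w) ⁻¹' (blaschkeValues z '' K)) :=
    ((isCompact_closedPseudoPolydisk z r).image_of_continuousOn hcont).isClosed.preimage hpath
  have hsub : Icc (0 : ℝ) 1 ⊆ (fun t : ℝ => t • w) ⁻¹' (blaschkeValues z '' K) := by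
    refine (hclosed.inter isClosed_Icc).Icc_subset_of_forall_mem_nhdsWithin ?_ ?_
    -- At `t = 0` the zeros are the points `z k` themselves.
    · refine ⟨z, fun k => ⟨(hz k).le, ?_⟩, ?_⟩
      · simp only [sub_self, norm_zero]; positivity
      · funext j
        rw [blaschkeValues, Finset.prod_eq_zero (Finset.mem_univ j) (by simp [blaschkeFactor])]
        simp
    · rintro t ⟨⟨ζ, hζ, hζt⟩, ht⟩
      refine mem_nhdsWithin_of_mem_nhds (hpath.continuousAt.preimage_mem_nhds ?_)
      simp only at hζt ⊢
      rw [← hζt, ← map_nhds_blaschkeValues hz (hK1 ζ hζ) hzi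
        (injective_of_mem_closedPseudoPolydisk hz hr0 hr hrδ hδ hζ)]
      refine Filter.image_mem_map ?_
      refine Filter.eventually_all.mpr fun k => ?_
      have hk : Filter.Tendsto (fun η : ι → ℂ => η k) (nhds ζ) (nhds (ζ k)) :=
        (continuous_apply k).continuousAt
      -- The value at `z k` has modulus at most `r²` and the other factors multiply to more than
      -- `r`, so `ρ(z k, ζ k) < r`: the solution is interior, and nearby zeros stay in the polydisk.
      have hlt : ‖ζ k - z k‖ < r * ‖1 - conj (z k) * ζ k‖ := by
        have h1 := norm_blaschkeValues z ζ k
        have h2 := lt_prod_pseudoDist hz hr0 hr hrδ (hδ k) hζ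
        have h3 : ‖blaschkeValues z ζ k‖ ≤ r ^ 2 := by
          rw [hζt, Pi.smul_apply, norm_smul, Real.norm_of_nonneg ht.1]
          nlinarith [norm_nonneg (w k), hw k, ht.1, ht.2]
        have h4 : pseudoDist (ζ k) (z k) < r := by
          rw [pseudoDist_comm]
          by_contra! h5
          nlinarith [pseudoDist_nonneg (z k) (ζ k)]
        rwa [pseudoDist_eq_div, div_lt_iff₀
          (norm_pos_iff.mpr (one_sub_conj_mul_ne_zero (hz k) (hK1 ζ hζ k).le))] at h4
      refine (hk.norm.eventually (ge_mem_nhds (hK1 ζ hζ k))).and ?_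
      filter_upwards [(hk.sub_const (z k)).norm.eventually_lt
        (((hk.const_mul (conj (z k))).const_sub 1).norm.const_mul r) hlt] with η hη using hη.le
  obtain ⟨ζ, hζ, h⟩ := hsub (right_mem_Icc.mpr zero_le_one)
  exact ⟨ζ, hK1 ζ hζ, by simpa using h⟩

end

/-! ### Blaschke products of a contraction -/

/-- The functional calculus `g ↦ X diag(g) X⁻¹` of a diagonalization. -/
noncomputable def diagCalculus {n : ℕ} (X : (Matrix (Fin n) (Fin n) ℂ)ˣ) :
    (Fin n → ℂ) →ₐ[ℂ] Matrix (Fin n) (Fin n) ℂ :=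
  (MulSemiringAction.toAlgEquiv ℂ (Matrix (Fin n) (Fin n) ℂ)
    (ConjAct.toConjAct X)).toAlgHom.comp (Matrix.diagonalAlgHom ℂ)

theorem diagCalculus_apply {n : ℕ} (X : (Matrix (Fin n) (Fin n) ℂ)ˣ) (g : Fin n → ℂ) :
    diagCalculus X g = (X : Matrix (Fin n) (Fin n) ℂ) * Matrix.diagonal g *
      ((X⁻¹ : (Matrix (Fin n) (Fin n) ℂ)ˣ) : Matrix (Fin n) (Fin n) ℂ) := rfl

theorem IsDiagonalization.mem_spectrum {n : ℕ} {A : Matrix (Fin n) (Fin n) ℂ}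
    {X : (Matrix (Fin n) (Fin n) ℂ)ˣ} {d : Fin n → ℂ} (h : IsDiagonalization A X d) (i : Fin n) :
    d i ∈ spectrum ℂ A := by
  rw [IsDiagonalization] at h
  rw [h, spectrum.units_conjugate, spectrum_diagonal]
  exact mem_range_self i

/-- The cross terms agree, and the difference of the squared norms is `(‖u‖² - ‖v‖²) (1 - ‖ζ‖²)`. -/
theorem norm_sub_smul_le_norm_sub_conj_smul {E : Type*} [NormedAddCommGroup E] [InnerProductSpace ℂ E] {u v : E}
    {ζ : ℂ} (hζ : ‖ζ‖ ≤ 1) (h : ‖v‖ ≤ ‖u‖) : ‖v - ζ • u‖ ≤ ‖u - conj ζ • v‖ := by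
  refine le_of_sq_le_sq ?_ (norm_nonneg _)
  rw [@norm_sub_sq ℂ, @norm_sub_sq ℂ, inner_smul_right, inner_smul_right, norm_smul, norm_smul,
    RCLike.norm_conj]
  have h1 : RCLike.re (ζ * inner ℂ v u) = RCLike.re (conj ζ * inner ℂ u v) := by
    rw [← inner_conj_symm u v, ← map_mul, RCLike.conj_re]
  rw [h1]
  have h2 : ‖v‖ ^ 2 ≤ ‖u‖ ^ 2 := by gcongr
  have h3 : ‖ζ‖ ^ 2 ≤ 1 := pow_le_one₀ (norm_nonneg _) hζ
  nlinarith [mul_nonneg (sub_nonneg.mpr h2) (sub_nonneg.mpr h3)]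

/-- Here `B` is the Blaschke factor of `A`. Writing `x = u - conj ζ A u` with `u = R x` gives `B x =
A u - ζ u`, and the previous inequality applies with `v = A u`. -/
theorem norm_le_one_of_mul_eq {n : ℕ} {A B R : Matrix (Fin n) (Fin n) ℂ} {ζ : ℂ} (hA : ‖A‖ ≤ 1)
    (hζ : ‖ζ‖ ≤ 1) (hB : B * (1 - conj ζ • A) = A - ζ • 1) (hR : (1 - conj ζ • A) * R = 1) :
    ‖B‖ ≤ 1 := by
  rw [← Matrix.l2_opNorm_toEuclideanCLM] at hA ⊢
  set φ := Matrix.toEuclideanCLM (n := Fin n) (𝕜 := ℂ)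
  have hB' : φ B * (1 - conj ζ • φ A) = φ A - ζ • 1 := by
    rw [← map_one φ, ← map_smul, ← map_smul, ← map_sub, ← map_sub, ← map_mul, hB]
  have hR' : (1 - conj ζ • φ A) * φ R = 1 := by
    rw [← map_one φ, ← map_smul, ← map_sub, ← map_mul, hR]
  refine ContinuousLinearMap.opNorm_le_bound _ zero_le_one fun x => ?_
  set u := φ R x
  have hx : x = u - conj ζ • φ A u := by
    have := DFunLike.congr_fun hR' x
    simpa using this.symm
  have hBx : φ B x = φ A u - ζ • u := by
    have := DFunLike.congr_fun hB' u
    rw [hx]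
    simpa using this
  rw [one_mul, hBx, hx]
  refine norm_sub_smul_le_norm_sub_conj_smul hζ (((φ A).le_opNorm u).trans ?_)
  exact mul_le_of_le_one_left (norm_nonneg _) hA

theorem norm_diagCalculus_blaschkeFactor_le {n : ℕ} {A : Matrix (Fin n) (Fin n) ℂ}
    {X : (Matrix (Fin n) (Fin n) ℂ)ˣ} {d : Fin n → ℂ} (h : IsDiagonalization A X d)
    (hA : ‖A‖ ≤ 1) (hd : ∀ i, ‖d i‖ < 1) {ζ : ℂ} (hζ : ‖ζ‖ < 1) :
    ‖diagCalculus X fun i => blaschkeFactor ζ (d i)‖ ≤ 1 := by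
  have hA' : A = diagCalculus X d := h
  have h1 : 1 - conj ζ • A = diagCalculus X (fun i => 1 - conj ζ * d i) := by
    rw [hA', ← map_one (diagCalculus X), ← map_smul, ← map_sub]
    rfl
  refine norm_le_one_of_mul_eq (R := diagCalculus X fun i => (1 - conj ζ * d i)⁻¹) hA hζ.le ?_ ?_
  · rw [h1, hA', ← map_one (diagCalculus X), ← map_smul, ← map_sub, ← map_mul]
    congr 1
    funext i
    have := one_sub_conj_mul_ne_zero hζ (hd i).le
    simp [blaschkeFactor, this]
  · rw [h1, ← map_mul, ← map_one (diagCalculus X)]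
    congr 1
    funext i
    exact mul_inv_cancel₀ (one_sub_conj_mul_ne_zero hζ (hd i).le)

theorem norm_diagCalculus_prod_blaschkeFactor_le {n : ℕ} {A : Matrix (Fin n) (Fin n) ℂ}
    {X : (Matrix (Fin n) (Fin n) ℂ)ˣ} {d : Fin n → ℂ} (h : IsDiagonalization A X d)
    (hA : ‖A‖ ≤ 1) (hd : ∀ i, ‖d i‖ < 1) {κ : Type*} {ζ : κ → ℂ} (hζ : ∀ k, ‖ζ k‖ < 1)
    (s : Finset κ) : ‖diagCalculus X fun i => ∏ k ∈ s, blaschkeFactor (ζ k) (d i)‖ ≤ 1 := by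
  classical
  induction s using Finset.induction_on with
  | empty =>
    have h1 : (diagCalculus X fun _ => (1 : ℂ)) = Matrix.diagonal fun _ => (1 : ℂ) := by
      rw [Matrix.diagonal_one]; exact map_one (diagCalculus X)
    simp only [Finset.prod_empty]
    rw [h1, Matrix.l2_opNorm_diagonal, pi_norm_le_iff_of_nonneg zero_le_one]
    simp
  | insert a s ha ih =>
    have h1 : (fun i => ∏ k ∈ insert a s, blaschkeFactor (ζ k) (d i)) =
        (fun i => blaschkeFactor (ζ a) (d i)) * fun i => ∏ k ∈ s, blaschkeFactor (ζ k) (d i) := by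
      funext i; simp [Finset.prod_insert ha]
    rw [h1, map_mul]
    exact (norm_mul_le _ _).trans (mul_le_one₀
      (norm_diagCalculus_blaschkeFactor_le h hA hd (hζ a)) (norm_nonneg _) ih)

/-! ### The bound -/

theorem sq_mul_norm_matrixFun_le {n : ℕ} {A : Matrix (Fin n) (Fin n) ℂ} (hnorm : ‖A‖ ≤ 1)
    (hdistinct : (spectrum ℂ A).ncard = n) (hspec : spectrum ℂ A ⊆ ball (0 : ℂ) 1)
    [Fintype (spectrum ℂ A)] [DecidableEq (spectrum ℂ A)] {r δ : ℝ} (hr0 : 0 < r) (hr : r < 1)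
    (hrδ : 2 * r < δ * (1 + r ^ 2))
    (hδ : ∀ j : spectrum ℂ A, δ ≤ ∏ k ∈ Finset.univ.erase j, pseudoDist (j : ℂ) (k : ℂ))
    {f : ℂ → ℂ} {S : ℝ} (hS : ∀ z ∈ spectrum ℂ A, ‖f z‖ ≤ S) (hS0 : 0 ≤ S) :
    r ^ 2 * ‖matrixFun f A‖ ≤ S := by
  obtain ⟨X, d, h⟩ := exists_isDiagonalization hdistinct
  have hdisk : ∀ z ∈ spectrum ℂ A, ‖z‖ < 1 := fun z hz => by simpa using hspec hz
  obtain ⟨ζ, hζ, hw⟩ := exists_blaschkeValues_eq (z := fun j : spectrum ℂ A => (j : ℂ))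
    (fun j => hdisk j j.2) Subtype.val_injective hr0 hr hrδ hδ
    (w := fun j => (r ^ 2 : ℝ) * (f j / S)) (fun j => by
      rw [norm_mul, norm_div, Complex.norm_real, Complex.norm_real, Real.norm_of_nonneg hS0,
        Real.norm_of_nonneg (sq_nonneg r)]
      exact mul_le_of_le_one_right (sq_nonneg r) (div_le_one_of_le₀ (hS j j.2) hS0))
  have hfun : ((r ^ 2 : ℝ) : ℂ) • (fun i => f (d i)) =
      (S : ℂ) • fun i => ∏ k, blaschkeFactor (ζ k) (d i) := by
    funext i
    have h1 := congrFun hw ⟨d i, h.mem_spectrum i⟩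
    have h2 := hS _ (h.mem_spectrum i)
    simp only [blaschkeValues] at h1
    rw [Pi.smul_apply, Pi.smul_apply, h1, smul_eq_mul, smul_eq_mul]
    -- When `S = 0`, the data `f / S` are `0` by convention, and the identity holds because `f`
    -- vanishes on the spectrum.
    rcases hS0.eq_or_lt with h0 | h0
    · rw [← h0, norm_le_zero_iff] at h2
      simp [h2]
    · have : (S : ℂ) ≠ 0 := by exact_mod_cast h0.ne'
      field_simp
  have hnf : ‖((r ^ 2 : ℝ) : ℂ) • matrixFun f A‖ = r ^ 2 * ‖matrixFun f A‖ := by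
    rw [norm_smul, Complex.norm_real, Real.norm_of_nonneg (sq_nonneg r)]
  rw [← hnf, matrixFun_eq f h, ← diagCalculus_apply, ← map_smul, hfun, map_smul, norm_smul,
    Complex.norm_real, Real.norm_of_nonneg hS0]
  exact mul_le_of_le_one_right hS0 (norm_diagCalculus_prod_blaschkeFactor_le h hnorm
    (fun i => hdisk _ (h.mem_spectrum i)) hζ _)

theorem separationConst_eq_iInf_prod {ι : Type*} [Fintype ι] [DecidableEq ι] (z : ι → ℂ) :
    separationConst z = ⨅ j, ∏ k ∈ Finset.univ.erase j, pseudoDist (z j) (z k) := by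
  refine iInf_congr fun j => ?_
  rw [tprod_fintype]
  exact (Finset.prod_subtype _ (by simp) fun k => pseudoDist (z j) (z k)).symm

theorem separationConst_le_prod {ι : Type*} [Fintype ι] [DecidableEq ι] (z : ι → ℂ) (j : ι) :
    separationConst z ≤ ∏ k ∈ Finset.univ.erase j, pseudoDist (z j) (z k) := by
  rw [separationConst_eq_iInf_prod]
  exact ciInf_le (Set.finite_range _).bddBelow j

theorem separationConst_pos {ι : Type*} [Finite ι] [Nonempty ι] {z : ι → ℂ}
    (hz : ∀ j, ‖z j‖ < 1) (hzi : Function.Injective z) : 0 < separationConst z := by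
  classical
  have := Fintype.ofFinite ι
  obtain ⟨j, hj⟩ := exists_eq_ciInf_of_finite
    (f := fun j => ∏ k ∈ Finset.univ.erase j, pseudoDist (z j) (z k))
  rw [separationConst_eq_iInf_prod, ← hj]
  refine Finset.prod_pos fun k hk => norm_pos_iff.mpr (div_ne_zero (sub_ne_zero.mpr fun h => ?_)
    (one_sub_conj_mul_ne_zero (hz k) (hz j).le))
  exact (Finset.mem_erase.mp hk).1 (hzi h).symm

theorem separationConst_le_one {ι : Type*} [Finite ι] [Nonempty ι] {z : ι → ℂ}
    (hz : ∀ j, ‖z j‖ < 1) : separationConst z ≤ 1 := by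
  classical
  have := Fintype.ofFinite ι
  obtain ⟨j⟩ := ‹Nonempty ι›
  exact (separationConst_le_prod z j).trans (Finset.prod_le_one (fun k _ => pseudoDist_nonneg _ _)
    fun k _ => (pseudoDist_lt_one (hz j) (hz k)).le)

/-- `M(δ) = ρ⁻²`, where `ρ` is the smaller root of `δ (1 + ρ²) = 2 ρ`. -/
theorem exists_earlConst_eq {δ : ℝ} (hδ0 : 0 < δ) (hδ1 : δ ≤ 1) :
    ∃ ρ : ℝ, 0 < ρ ∧ ρ ≤ 1 ∧ earlConst δ * ρ ^ 2 = 1 ∧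
      ∀ r < ρ, 2 * r < δ * (1 + r ^ 2) := by
  set s := Real.sqrt (1 - δ ^ 2)
  have hδ2 : 0 ≤ 1 - δ ^ 2 := by nlinarith
  have hs0 : 0 ≤ s := Real.sqrt_nonneg _
  have hs2 : s ^ 2 = 1 - δ ^ 2 := Real.sq_sqrt hδ2
  have hs1 : s < 1 := by nlinarith
  have hsqrt : Real.sqrt (1 / δ ^ 2 - 1) = s / δ := by
    rw [← Real.sqrt_sq hδ0.le, ← Real.sqrt_div hδ2, Real.sqrt_sq hδ0.le]
    congr 1
    field_simp
  refine ⟨(1 - s) / δ, div_pos (by linarith) hδ0, ?_, ?_, fun r hr => ?_⟩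
  · rw [div_le_one hδ0]
    nlinarith
  · rw [earlConst, hsqrt, ← mul_pow, ← add_div, div_mul_div_comm]
    have h1 : (1 + s) * (1 - s) = δ * δ := by linear_combination -hs2
    rw [h1, div_self (by positivity), one_pow]
  · rw [lt_div_iff₀ hδ0] at hr
    have h1 : 0 < (1 - s - r * δ) * (1 + s - r * δ) := mul_pos (by linarith) (by linarith)
    -- The roots of `δ (1 + r²) = 2 r` are `(1 ± s) / δ`; below the smaller one both factors are
    -- positive.
    have h2 : (1 - s - r * δ) * (1 + s - r * δ) = δ * (δ * (1 + r ^ 2) - 2 * r) := by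
      linear_combination -hs2
    rw [h2] at h1
    have := (pos_iff_pos_of_mul_pos h1).mp hδ0
    linarith

end CrouzeixBound

theorem theorem2 {n : ℕ} (hn : 0 < n) (A : Matrix (Fin n) (Fin n) ℂ)
    (hnorm : ‖A‖ ≤ 1)
    (hdistinct : (spectrum ℂ A).ncard = n)
    (hspec : spectrum ℂ A ⊆ Metric.ball (0 : ℂ) 1)
    (f : ℂ → ℂ) (hf : CrouzeixBound.MemHInfty f) :
    ‖CrouzeixBound.matrixFun f A‖ ≤
      CrouzeixBound.earlConst (CrouzeixBound.matrixSeparationConst A) *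
        ⨆ z : spectrum ℂ A, ‖f z‖ := by
  classical
  -- An infinite set has `ncard` zero, so `n > 0` gives finiteness as well as nonemptiness.
  have hfin : (spectrum ℂ A).Finite := Set.finite_of_ncard_pos (by omega)
  have := hfin.fintype
  have hne : Nonempty (spectrum ℂ A) :=
    (Set.nonempty_of_ncard_ne_zero (by omega : (spectrum ℂ A).ncard ≠ 0)).to_subtype
  have hz : ∀ j : spectrum ℂ A, ‖(j : ℂ)‖ < 1 := fun j => by simpa using hspec j.2
  obtain ⟨ρ, hρ0, hρ1, hρ, hlt⟩ := CrouzeixBound.exists_earlConst_eq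
    (CrouzeixBound.separationConst_pos hz Subtype.val_injective)
    (CrouzeixBound.separationConst_le_one hz)
  set S := ⨆ z : spectrum ℂ A, ‖f z‖
  have hS : ∀ z ∈ spectrum ℂ A, ‖f z‖ ≤ S := fun z hz =>
    le_ciSup (f := fun z : spectrum ℂ A => ‖f z‖) (Set.finite_range _).bddAbove ⟨z, hz⟩
  have hS0 : 0 ≤ S := Real.iSup_nonneg fun _ => norm_nonneg _
  -- Interpolation needs `2 r < δ (1 + r²)` strictly, which fails at `ρ` itself, so the bound is
  -- taken for `r < ρ` and passed to the limit.
  have hle : ρ ^ 2 * ‖CrouzeixBound.matrixFun f A‖ ≤ S := by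
    have ht : Filter.Tendsto (fun r : ℝ => r ^ 2 * ‖CrouzeixBound.matrixFun f A‖)
        (nhdsWithin ρ (Set.Iio ρ)) (nhds (ρ ^ 2 * ‖CrouzeixBound.matrixFun f A‖)) :=
      ((continuous_pow 2).mul continuous_const).continuousAt.tendsto.mono_left nhdsWithin_le_nhds
    refine le_of_tendsto ht ?_
    filter_upwards [Ioo_mem_nhdsLT hρ0] with r hr
    exact CrouzeixBound.sq_mul_norm_matrixFun_le hnorm hdistinct hspec hr.1 (hr.2.trans_le hρ1)
      (hlt r hr.2) (CrouzeixBound.separationConst_le_prod _) hS hS0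
  have hM : 0 ≤ CrouzeixBound.earlConst (CrouzeixBound.matrixSeparationConst A) := sq_nonneg _
  calc ‖CrouzeixBound.matrixFun f A‖
      = CrouzeixBound.earlConst (CrouzeixBound.matrixSeparationConst A) *
          (ρ ^ 2 * ‖CrouzeixBound.matrixFun f A‖) := by
        rw [← mul_assoc, CrouzeixBound.matrixSeparationConst, hρ, one_mul]
    _ ≤ _ := mul_le_mul_of_nonneg_left hle hM
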